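/- **Theorem.** Let $V=\{x_1,x_2,x_3,y_1,y_2,y_3,z_1,z_2,z_3,v_1,v_2,v_3\}$ be a set of $12$ elements. For distinct $p_1,p_2,p_3,q_1,q_2,q_3\in V$ let $$\Diamond([p_1,p_2,p_3],[q_1,q_2,q_3])=\langle\{p_1\},\{q_1\}\rangle*\langle\{p_2\},\{q_2\}\rangle*\langle\{p_3\},\{q_3\}\rangle,$$ where $\langle F_1,\dots,F_k\rangle$ is the simplicial complex generated by $F_1,\dots,F_k$ and $*$ is the simplicial join, so that this is the boundary complex of the octahedron in which $p_i$ and $q_i$ are opposite vertices. Let $$\Gamma_1=\{v_1\}*\Diamond([x_1,x_2,x_3],[y_1,y_2,y_3])\;\cup\;\{v_2\}*\Diamond([y_1,y_2,y_3],[z_1,z_2,z_3])\;\cup\;\{v_3\}*\Diamond([x_1,x_2,x_3],[z_3,z_1,z_2]),$$ where $\{v\}*K$ is the cone over $K$ with apex $v$. Let $F$ be the following family of nine subsets of an auxiliary nine-element set $\{a_j,b_j,c_j : j=1,2,3\}$ (strings denote sets): $$a_1b_1c_1c_2,\ a_1b_1b_2c_2,\ a_1a_2b_2c_2,\ a_2b_2c_2c_3,\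 a_2b_2b_3c_3,\ a_2a_3b_3c_3,\ a_3b_3c_3c_1,\ a_3b_3b_1c_1,\ a_3a_1b_1c_1,$$ and let $\Gamma_2=\langle\varphi(F)\rangle$ be the complex generated by their images under the bijection $$\varphi:\ a_1\mapsto z_2,\ a_2\mapsto z_3,\ a_3\mapsto z_1,\ b_1\mapsto y_3,\ b_2\mapsto y_1,\ b_3\mapsto y_2,\ c_1\mapsto x_1,\ c_2\mapsto x_2,\ c_3\mapsto x_3.$$ Let $\Delta_{12,33}=\Gamma_1\cup\Gamma_2$, a $3$-dimensional simplicial complex with $12$ vertices and $33$ facets. An *induced equator* of a simplicial complex $\Delta$ is an induced subcomplex $E=\Delta[S]=\{G\in\Delta: G\subseteq S\}$, $S$ a set of vertices, whose geometric realization is homeomorphic to a sphere of dimension $\dim\Delta-1$ (for $\Delta_{12,33}$: to the $2$-sphere). Then every induced equator of $\Delta_{12,33}$ is the link of a vertex: if $E$ is an induced equator of $\Delta_{12,33}$, then there is a vertex $w$ of $\Delta_{12,33}$ such that $$E=\mathrm{lk}_{\Delta_{12,33}}(w)=\{G\in\Delta_{12,33}: w\notin G,\ G\cup\{w\}\in\Delta_{12,33}\}.$$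 -/

import Mathlib

namespace FlagSphere

section General

variable {V : Type*} [DecidableEq V]

/-- The simplicial complex `⟨F₁, …, Fₖ⟩`, consisting of all nonempty subsets of the `Fᵢ`.
(Faces are nonempty by Mathlib's convention; the empty face is left implicit.) -/
def generated (facets : Finset (Finset V)) : PreAbstractSimplicialComplex V where
  faces := {G | G.Nonempty ∧ ∃ F ∈ facets, G ⊆ F}
  isRelLowerSet_faces := by
    rintro G ⟨hG, F, hF, hGF⟩
    exact ⟨hG, fun H hHG hH => ⟨hH, F, hF, hHG.trans hGF⟩⟩

/-- The simplicial join `K * L = {F ∪ G : F ∈ K, G ∈ L}`, where either of `F` and `G`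
may be the (implicit) empty face, but not both. -/
def join (K L : PreAbstractSimplicialComplex V) : PreAbstractSimplicialComplex V where
  faces := {H | H.Nonempty ∧ ∃ F G : Finset V,
    (F = ∅ ∨ F ∈ K.faces) ∧ (G = ∅ ∨ G ∈ L.faces) ∧ H = F ∪ G}
  isRelLowerSet_faces := by
    rintro H ⟨hH, F, G, hF, hG, rfl⟩
    refine ⟨hH, fun H' hsub hne => ⟨hne, H' ∩ F, H' ∩ G, ?_, ?_, ?_⟩⟩
    · rcases (H' ∩ F).eq_empty_or_nonempty with h | h
      · exact Or.inl h
      · rcases hF with rfl | hF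
        · simp at h
        · exact Or.inr ((K.isRelLowerSet_faces hF).2 Finset.inter_subset_right h)
    · rcases (H' ∩ G).eq_empty_or_nonempty with h | h
      · exact Or.inl h
      · rcases hG with rfl | hG
        · simp at h
        · exact Or.inr ((L.isRelLowerSet_faces hG).2 Finset.inter_subset_right h)
    · rw [← Finset.inter_union_distrib_left]
      exact (Finset.inter_eq_left.2 hsub).symm

/-- The cone `{v} * K`. -/
def cone (v : V) (K : PreAbstractSimplicialComplex V) : PreAbstractSimplicialComplex V :=
  join (generated {{v}}) K

/-- `◇([a₁, a₂, a₃], [b₁, b₂, b₃]) = ⟨{a₁}, {b₁}⟩ * ⟨{a₂}, {b₂}⟩ * ⟨{a₃}, {b₃}⟩`: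
the boundary complex of the octahedron in which `aᵢ` and `bᵢ` are opposite vertices. -/
def octahedron (a b : Fin 3 → V) : PreAbstractSimplicialComplex V :=
  join (join (generated {{a 0}, {b 0}}) (generated {{a 1}, {b 1}})) (generated {{a 2}, {b 2}})

/-- The induced subcomplex `Δ[W] = {F ∈ Δ : F ⊆ W}`. -/
def induced (Δ : PreAbstractSimplicialComplex V) (W : Finset V) :
    PreAbstractSimplicialComplex V where
  faces := {F | F ∈ Δ.faces ∧ F ⊆ W}
  isRelLowerSet_faces := by
    rintro F ⟨hF, hFW⟩
    exact ⟨(Δ.isRelLowerSet_faces hF).1,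
      fun G hGF hG => ⟨(Δ.isRelLowerSet_faces hF).2 hGF hG, hGF.trans hFW⟩⟩

/-- The link `{G ∈ Δ : F ∪ G ∈ Δ, F ∩ G = ∅}` of `F` in `Δ`. -/
def link (Δ : PreAbstractSimplicialComplex V) (F : Finset V) :
    PreAbstractSimplicialComplex V where
  faces := {G | G ∈ Δ.faces ∧ F ∪ G ∈ Δ.faces ∧ F ∩ G = ∅}
  isRelLowerSet_faces := by
    rintro G ⟨hG, hFG, hdisj⟩
    refine ⟨(Δ.isRelLowerSet_faces hG).1, fun H hHG hH =>
      ⟨(Δ.isRelLowerSet_faces hG).2 hHG hH, (Δ.isRelLowerSet_faces hFG).2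
        (Finset.union_subset_union_right hHG) (hH.mono Finset.subset_union_right), ?_⟩⟩
    exact Finset.subset_empty.1 (hdisj ▸ Finset.inter_subset_inter_left hHG)

/-- `Δ` has dimension `d`: the largest cardinality of a face is `d + 1`. -/
def HasDimension (Δ : PreAbstractSimplicialComplex V) (d : ℕ) : Prop :=
  IsGreatest {n : ℕ | ∃ F ∈ Δ.faces, F.card = n} (d + 1)

variable [Fintype V]

/-- The geometric realization `|Δ|`, in barycentric coordinates: the union, over the faces `F`,
of the faces of the standard simplex in `ℝ^V` that are spanned by `F`. -/
def realization (Δ : PreAbstractSimplicialComplex V) : Set (V → ℝ) :=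
  {f | f ∈ stdSimplex ℝ V ∧ ∃ F ∈ Δ.faces, ∀ v, f v ≠ 0 → v ∈ F}

/-- `Δ` is a simplicial `d`-sphere: `|Δ|` is homeomorphic to the unit sphere of `ℝ^(d+1)`. -/
def IsSimplicialSphere (d : ℕ) (Δ : PreAbstractSimplicialComplex V) : Prop :=
  Nonempty (realization Δ ≃ₜ Metric.sphere (0 : EuclideanSpace ℝ (Fin (d + 1))) 1)

/-- `E` is an induced equator of `Δ`: an induced subcomplex which is a simplicial sphere of
codimension one in `Δ`. -/
def IsInducedEquator (Δ E : PreAbstractSimplicialComplex V) : Prop :=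
  (∃ W : Finset V, E = induced Δ W) ∧
    ∃ d : ℕ, HasDimension Δ (d + 1) ∧ IsSimplicialSphere d E

end General

/-- The twelve vertices. -/
inductive Vertex
  | x1 | x2 | x3 | y1 | y2 | y3 | z1 | z2 | z3 | v1 | v2 | v3
  deriving DecidableEq

open Vertex in
instance : Fintype Vertex where
  elems := {x1, x2, x3, y1, y2, y3, z1, z2, z3, v1, v2, v3}
  complete := by intro v; cases v <;> decide

/-- The vertices `(i, j)`, written `i_j`, of the product of the triangle `abc` with the
3-cycle `123`. -/
inductive PrismVertex
  | a1 | a2 | a3 | b1 | b2 | b3 | c1 | c2 | c3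
  deriving DecidableEq

open Vertex in
/-- The solid torus `Γ₁`, a union of three cones over octahedra. -/
def Gamma1 : PreAbstractSimplicialComplex Vertex :=
  cone v1 (octahedron ![x1, x2, x3] ![y1, y2, y3]) ⊔
  cone v2 (octahedron ![y1, y2, y3] ![z1, z2, z3]) ⊔
  cone v3 (octahedron ![x1, x2, x3] ![z3, z1, z2])

open PrismVertex in
/-- The nine facets of the staircase triangulation of the product of a triangle and a 3-cycle. -/
def prismFacets : Finset (Finset PrismVertex) :=
  {{a1, b1, c1, c2}, {a1, b1, b2, c2}, {a1, a2, b2, c2},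
   {a2, b2, c2, c3}, {a2, b2, b3, c3}, {a2, a3, b3, c3},
   {a3, b3, c3, c1}, {a3, b3, b1, c1}, {a3, a1, b1, c1}}

/-- The bijection identifying the vertices of the two solid tori. -/
def phi : PrismVertex → Vertex
  | .a1 => .z2 | .a2 => .z3 | .a3 => .z1
  | .b1 => .y3 | .b2 => .y1 | .b3 => .y2
  | .c1 => .x1 | .c2 => .x2 | .c3 => .x3

/-- The solid torus `Γ₂`. -/
def Gamma2 : PreAbstractSimplicialComplex Vertex :=
  generated (prismFacets.image (fun F => F.image phi))

/-- The simplicial complex `Δ_{12,33}`, with 12 vertices and 33 facets. -/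
def Delta1233 : PreAbstractSimplicialComplex Vertex :=
  Gamma1 ⊔ Gamma2

end FlagSphere

/-!
An induced subcomplex `E = Delta1233[W]` homeomorphic to the two-sphere is recognised by local
conditions at single points, for which no homology is needed.

On a punctured neighbourhood of a point `p` of the two-sphere, a planar chart centred at `p` is a
continuous nowhere vanishing complex function which winds once around `0`, so that it has no
continuous logarithm (`not_hasLogs_punctured_of_homeomorph_sphere`). On the other hand, continuous
logarithms always exist on star-convex sets, by lifting a contraction through the exponential
covering, and on unions of two open pieces with connected overlap. This gives them on the open star
of each of the following faces with its barycentre deleted: an isolated vertex (nothing is left), a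
maximal edge (two convex pieces), an edge in exactly one triangle (a punctured half-disc), and a
tetrahedron (a punctured three-ball, which is the union of the complements of two opposite
half-lines). So a simplicial two-sphere contained in a three-dimensional complex has no
tetrahedron, no isolated vertex, and at least two triangles on each edge
(`IsSimplicialSphere.card_ne_four`, `IsSimplicialSphere.exists_edge_of_vertex`,
`IsSimplicialSphere.exists_two_triangles`).

These necessary conditions suffice: by inspection of all subsets `W` of the twelve vertices
(`vertexSet_cases`), each nonempty `W` whose induced subcomplex satisfies them is the set of
neighbours of a vertex. As neighbours of a vertex `a` that span a face span one together with `a`,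
the complex induced on them is the link of `a` (`induced_nbrs_eq_link`).
-/

namespace FlagSphere

/-! ### Continuous logarithms -/

section Logarithms

variable {E : Type*} [TopologicalSpace E]

/-- Every continuous nowhere vanishing complex function on `S` has a continuous logarithm;
equivalently, every continuous map from `S` to the circle is null-homotopic. -/
def HasLogs (S : Set E) : Prop :=
  ∀ f : E → ℂ, ContinuousOn f S → (∀ x ∈ S, f x ≠ 0) →
    ∃ g : E → ℂ, ContinuousOn g S ∧ ∀ x ∈ S, Complex.exp (g x) = f x

theorem hasLogs_empty : HasLogs (∅ : Set E) := fun _ _ _ => ⟨0, by simp, by simp⟩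

theorem eqOn_of_exp_eq {S : Set E} (hS : IsPreconnected S) {g : E → ℂ} (hg : ContinuousOn g S)
    (h : ∀ x ∈ S, ∀ y ∈ S, Complex.exp (g x) = Complex.exp (g y)) :
    ∀ x ∈ S, ∀ y ∈ S, g x = g y := fun _ hx _ hy =>
  Complex.isCoveringMap_exp.constOn_of_comp hS hg
    (fun a ha b hb => Subtype.ext (h a ha b hb)) hx hy

/-- A Mayer–Vietoris argument: two logarithms differ by a constant on a connected overlap. -/
theorem HasLogs.union {S A B : Set E} (hA : IsOpen A) (hB : IsOpen B) (hS : S ⊆ A ∪ B)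
    (hSA : HasLogs (S ∩ A)) (hSB : HasLogs (S ∩ B)) (hAB : IsPreconnected (S ∩ (A ∩ B))) :
    HasLogs S := by
  classical
  intro f hf hf0
  obtain ⟨g, hg, hgf⟩ := hSA f (hf.mono Set.inter_subset_left) fun x hx => hf0 x hx.1
  obtain ⟨k, hk, hkf⟩ := hSB f (hf.mono Set.inter_subset_left) fun x hx => hf0 x hx.1
  obtain ⟨c, hc, hgk⟩ : ∃ c : ℂ, Complex.exp c = 1 ∧ ∀ x ∈ S ∩ (A ∩ B), g x = k x + c := by
    rcases (S ∩ (A ∩ B)).eq_empty_or_nonempty with h | ⟨x₀, hx₀⟩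
    · exact ⟨0, by simp, by simp [h]⟩
    · have hexp : ∀ x ∈ S ∩ (A ∩ B), Complex.exp (g x - k x) = 1 := fun x hx => by
        rw [Complex.exp_sub, hgf x ⟨hx.1, hx.2.1⟩, hkf x ⟨hx.1, hx.2.2⟩, div_self (hf0 x hx.1)]
      refine ⟨g x₀ - k x₀, hexp x₀ hx₀, fun x hx => ?_⟩
      have := eqOn_of_exp_eq hAB (g := fun x => g x - k x)
        ((hg.mono fun x hx => ⟨hx.1, hx.2.1⟩).sub (hk.mono fun x hx => ⟨hx.1, hx.2.2⟩))
        (fun x hx y hy => (hexp x hx).trans (hexp y hy).symm) x hx x₀ hx₀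
      linear_combination this
  refine ⟨fun x => if x ∈ A then g x else k x + c, fun x hx => ?_, fun x hx => ?_⟩
  · rcases hS hx with hxA | hxB
    · refine ContinuousWithinAt.congr_of_eventuallyEq (f := g) ?_ ?_ (by simp [hxA])
      · exact (hg x ⟨hx, hxA⟩).mono_of_mem_nhdsWithin
          (inter_mem_nhdsWithin S (hA.mem_nhds hxA))
      · filter_upwards [mem_nhdsWithin_of_mem_nhds (hA.mem_nhds hxA)] with y hy
        simp [hy]
    · have heq : ∀ y ∈ S, y ∈ B → (if y ∈ A then g y else k y + c) = k y + c := by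
        intro y hyS hyB
        split_ifs with hyA
        · exact hgk y ⟨hyS, hyA, hyB⟩
        · rfl
      refine ContinuousWithinAt.congr_of_eventuallyEq (f := fun y => k y + c) ?_ ?_ (heq x hx hxB)
      · exact ((hk x ⟨hx, hxB⟩).mono_of_mem_nhdsWithin
          (inter_mem_nhdsWithin S (hB.mem_nhds hxB))).add continuousWithinAt_const
      · filter_upwards [mem_nhdsWithin_of_mem_nhds (hB.mem_nhds hxB), self_mem_nhdsWithin]
          with y hy hyS using heq y hyS hy
  · by_cases hxA : x ∈ A
    · simpa [hxA] using hgf x ⟨hx, hxA⟩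
    · have hxB : x ∈ B := (hS hx).resolve_left hxA
      simpa [hxA, Complex.exp_add, hc] using hkf x ⟨hx, hxB⟩

end Logarithms

section Convex

variable {E : Type*} [AddCommGroup E] [Module ℝ E] [TopologicalSpace E] [ContinuousAdd E]
  [ContinuousSMul ℝ E]

/-- The contraction of a star-convex set to its centre lifts through the exponential covering. -/
theorem _root_.StarConvex.hasLogs {S : Set E} {s : E} (hS : StarConvex ℝ s S) : HasLogs S := by
  classical
  rcases S.eq_empty_or_nonempty with rfl | hne
  · exact hasLogs_empty
  have hs : s ∈ S := hS.mem hne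
  intro f hf hf0
  have hmem : ∀ a : unitInterval × S, (1 - (a.1 : ℝ)) • s + (a.1 : ℝ) • (a.2 : E) ∈ S :=
    fun a => hS a.2.2 (by linarith [a.1.2.2]) a.1.2.1 (by ring)
  let H : C(unitInterval × S, {z : ℂ // z ≠ 0}) :=
    ⟨fun a => ⟨f ((1 - (a.1 : ℝ)) • s + (a.1 : ℝ) • (a.2 : E)), hf0 _ (hmem a)⟩, by
      refine Continuous.subtype_mk (hf.comp_continuous (by fun_prop) hmem) _⟩
  let L : C(S, ℂ) := ContinuousMap.const _ (Complex.log (f s))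
  have H0 : ∀ a, H (0, a) = ⟨Complex.exp (L a), Complex.exp_ne_zero _⟩ := fun a =>
    Subtype.ext (by simp [H, L, Complex.exp_log (hf0 s hs)])
  let G := Complex.isCoveringMap_exp.liftHomotopy H L H0
  have hG : ∀ a : S, Complex.exp (G (1, a)) = f a := fun a => by
    have : Complex.exp (G (1, a)) = (H (1, a) : ℂ) := congrArg Subtype.val
      (congrFun (Complex.isCoveringMap_exp.liftHomotopy_lifts H L H0) (1, a))
    rw [this]
    simp [H]
  refine ⟨fun x => if hx : x ∈ S then G (1, ⟨x, hx⟩) else 0, ?_, fun x hx => ?_⟩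
  · rw [continuousOn_iff_continuous_domRestrict]
    have : S.domRestrict (fun x => if hx : x ∈ S then G (1, ⟨x, hx⟩) else 0) = fun a => G (1, a) := by
      ext a; simp
    rw [this]
    fun_prop
  · simpa [hx] using hG ⟨x, hx⟩

end Convex

/-! ### Punctured neighbourhoods in the two-sphere -/

/-- On a two-sphere the coordinate `z - c` of a planar chart winds once around `c`, so it has no
logarithm near `c`. Hence no point of a two-sphere has a neighbourhood `R ∩ O` which becomes
free of winding once the point is deleted. -/
theorem not_hasLogs_punctured_of_homeomorph_sphere {E : Type*} [TopologicalSpace E] {R O : Set E}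
    (h : R ≃ₜ Metric.sphere (0 : EuclideanSpace ℝ (Fin 3)) 1) (hO : IsOpen O) {p q : E}
    (hpR : p ∈ R) (hpO : p ∈ O) (hqR : q ∈ R) (hqO : q ∉ O) : ¬ HasLogs ((R ∩ O) \ {p}) := by
  classical
  intro hlogs
  have : Fact (Module.finrank ℝ (EuclideanSpace ℝ (Fin 3)) = 2 + 1) := ⟨by simp⟩
  let e := stereographic' 2 (h ⟨q, hqR⟩)
  let j := Complex.orthonormalBasisOneI.repr
  let k : ℂ → R := fun z => h.symm (e.symm (j z))
  let φ : R → ℂ := fun x => j.symm (e (h x))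
  have hk : Continuous k := by
    refine h.symm.continuous.comp (Continuous.comp ?_ j.continuous)
    have := e.continuousOn_symm
    rwa [stereographic'_target, continuousOn_univ] at this
  have hφk : ∀ z, φ (k z) = z := fun z => by
    have : j z ∈ e.target := by simp [e]
    simp [φ, k, e.right_inv this]
  have hmem : ∀ x : R, (x : E) ≠ q → h x ∈ e.source := fun x hx => by
    rw [stereographic'_source, Set.mem_compl_singleton_iff]
    exact fun he => hx (congrArg Subtype.val (h.injective he))
  have hkφ : ∀ x : R, (x : E) ≠ q → k (φ x) = x := fun x hx => by
    simp [φ, k, e.left_inv (hmem x hx)]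
  have hpq : p ≠ q := fun hpq => hqO (hpq ▸ hpO)
  set c := φ ⟨p, hpR⟩ with hc
  have hkc : k c = ⟨p, hpR⟩ := hkφ _ hpq
  have hkne : ∀ z, z ≠ c → (k z : E) ≠ p := fun z hz he => hz <| by
    rw [← hφk z, show k z = ⟨p, hpR⟩ from Subtype.ext he]
  let f : E → ℂ := fun x => if hx : x ∈ R then φ ⟨x, hx⟩ - c else 0
  have hfk : ∀ z, f (k z) = z - c := fun z => by simp [f, hφk]
  have hne : ∀ x ∈ (R ∩ O) \ {p}, x ≠ q := fun x hx hxq => hqO (hxq ▸ hx.1.2)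
  obtain ⟨g, hg, hgf⟩ := hlogs f
    (by
      rw [continuousOn_iff_continuous_domRestrict]
      have hrw : ((R ∩ O) \ {p}).domRestrict f =
          fun x : ((R ∩ O) \ {p} : Set E) => φ ⟨x, x.2.1.1⟩ - c := by
        ext x; simp [f, x.2.1.1]
      rw [hrw]
      refine Continuous.sub (j.symm.continuous.comp ?_) continuous_const
      exact e.continuousOn.comp_continuous
        (h.continuous.comp (continuous_subtype_val.subtype_mk _))
        fun x => hmem _ (hne x x.2))
    (by
      intro x hx hx0
      have hx1 : φ ⟨x, hx.1.1⟩ = c := by simpa [f, hx.1.1, sub_eq_zero] using hx0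
      have := hkφ ⟨x, hx.1.1⟩ (hne x hx)
      rw [hx1, hkc] at this
      exact hx.2 (congrArg Subtype.val this).symm)
  obtain ⟨r, hr, hball⟩ := Metric.mem_nhds_iff.1
    ((hO.preimage (continuous_subtype_val.comp hk)).mem_nhds
      (show c ∈ _ by simpa [hkc] using hpO))
  -- a circle of radius `r / 2` about `c`
  let z : ℝ → ℂ := fun t => c + (r / 2 : ℝ) * Complex.exp (t * Complex.I)
  have hz : Continuous z := by fun_prop
  have hr0 : ((r / 2 : ℝ) : ℂ) ≠ 0 := by exact_mod_cast (half_pos hr).ne'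
  have hzc : ∀ t, z t ≠ c := fun t => by
    simpa [z] using hr.ne'
  have hzS : ∀ t, (k (z t) : E) ∈ (R ∩ O) \ {p} := fun t => by
    refine ⟨⟨(k (z t)).2, hball ?_⟩, hkne _ (hzc t)⟩
    rw [Metric.mem_ball, dist_eq_norm]
    simp only [z, add_sub_cancel_left, norm_mul, Complex.norm_exp_ofReal_mul_I, mul_one,
      Complex.norm_real, Real.norm_eq_abs]
    rw [abs_of_pos (half_pos hr)]
    exact half_lt_self hr
  let G : ℝ → ℂ := fun t => g (k (z t)) - t * Complex.I
  have hG : Continuous G :=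
    (hg.comp_continuous (continuous_subtype_val.comp (hk.comp hz)) hzS).sub (by fun_prop)
  have hGexp : ∀ t, Complex.exp (G t) = (r / 2 : ℝ) := fun t => by
    simp only [G]
    rw [Complex.exp_sub, hgf _ (hzS t), hfk, add_sub_cancel_left,
      mul_div_cancel_right₀ _ (Complex.exp_ne_zero _)]
  have hconst := eqOn_of_exp_eq isPreconnected_univ hG.continuousOn
    (fun x _ y _ => (hGexp x).trans (hGexp y).symm) 0 trivial (2 * Real.pi) trivial
  have hz2 : z (2 * Real.pi) = z 0 := by simp [z]
  simp only [G, hz2, Complex.ofReal_zero, zero_mul, sub_zero] at hconst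
  have : (2 * Real.pi : ℂ) * Complex.I = 0 := by
    push_cast at hconst
    linear_combination hconst
  simp [Real.pi_ne_zero] at this

/-! ### Punctured convex sets -/

section PuncturedConvex

variable {E : Type*} [AddCommGroup E] [Module ℝ E] [TopologicalSpace E]

theorem convex_inter_pos {S : Set E} (hS : Convex ℝ S) (x : E →L[ℝ] ℝ) :
    Convex ℝ (S ∩ {f | 0 < x f}) :=
  hS.inter (convex_halfSpace_gt x.toLinearMap.isLinear 0)

/-- Deleting from a convex set a half-line that ends at the common zero of `x`, `y`, `z` leaves a
set that is star-convex about any point of the opposite half-line. -/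
theorem starConvex_diff_ray {S : Set E} (hS : Convex ℝ S) (x y z : E →L[ℝ] ℝ) {s : E}
    (hs : s ∈ S) (hx : x s = 0) (hy : y s = 0) (hz : 0 < z s) :
    StarConvex ℝ s (S ∩ {f | x f ≠ 0 ∨ y f ≠ 0 ∨ 0 < z f}) := by
  rintro f ⟨hf, hf'⟩ α β hα hβ hαβ
  refine ⟨hS hs hf hα hβ hαβ, ?_⟩
  simp only [Set.mem_ofPred_eq, map_add, map_smul, smul_eq_mul, hx, hy, mul_zero, zero_add] at hf' ⊢
  rcases hβ.eq_or_lt with rfl | hβ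
  · obtain rfl : α = 1 := by linarith
    simp [hz]
  · rcases hf' with h | h | h
    · exact Or.inl (mul_ne_zero hβ.ne' h)
    · exact Or.inr (Or.inl (mul_ne_zero hβ.ne' h))
    · exact Or.inr (Or.inr (by positivity))

variable [ContinuousAdd E] [ContinuousSMul ℝ E]

theorem _root_.Convex.hasLogs {S : Set E} (hS : Convex ℝ S) : HasLogs S := by
  rcases S.eq_empty_or_nonempty with rfl | ⟨s, hs⟩
  · exact hasLogs_empty
  · exact (hS hs).hasLogs

/-- A convex set of dimension at least two minus a subspace of codimension two is connected: it is
the union of four convex sets, consecutive ones of which meet. -/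
theorem isPreconnected_diff_codim_two {S : Set E} (hS : Convex ℝ S) (x y : E →L[ℝ] ℝ) {s t u : E}
    (hs : s ∈ S) (hxs : 0 < x s) (hys : 0 < y s) (ht : t ∈ S) (hxt : x t < 0) (hyt : 0 < y t)
    (hu : u ∈ S) (hxu : x u < 0) (hyu : y u < 0) :
    IsPreconnected (S ∩ {f | x f ≠ 0 ∨ y f ≠ 0}) := by
  let D : (E →L[ℝ] ℝ) → Set E := fun w => S ∩ {f | 0 < w f}
  have hc : ∀ w, IsPreconnected (D w) := fun w => (convex_inter_pos hS w).isPreconnected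
  have h1 : IsPreconnected (D x ∪ D y) := .union s ⟨hs, hxs⟩ ⟨hs, hys⟩ (hc x) (hc y)
  have h2 : IsPreconnected (D x ∪ D y ∪ D (-x)) :=
    .union t (Or.inr ⟨ht, hyt⟩) ⟨ht, by simpa using hxt⟩ h1 (hc (-x))
  have h : IsPreconnected (D x ∪ D y ∪ D (-x) ∪ D (-y)) :=
    .union u (Or.inr ⟨hu, by simpa using hxu⟩) ⟨hu, by simpa using hyu⟩ h2 (hc (-y))
  convert h using 1
  ext f
  simp only [D, Set.mem_inter_iff, Set.mem_ofPred_eq, Set.mem_union, neg_apply,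
    Left.neg_pos_iff, ← and_or_left]
  simp only [ne_iff_lt_or_gt]
  tauto

/-- Logarithms exist on a three-dimensional convex set minus an interior point `p`, which is the
union of the complements of two opposite half-lines issuing from `p`. The points `s`, `t`, `u`, in
three of the quadrants of the `xy`-plane, make the complement of the whole line connected. -/
theorem hasLogs_diff_singleton_of_three {S : Set E} (hS : Convex ℝ S) (x y z : E →L[ℝ] ℝ)
    {p r r' s t u : E} (hp : ∀ f ∈ S, f = p ↔ x f = 0 ∧ y f = 0 ∧ z f = 0)
    (hr : r ∈ S) (hxr : x r = 0) (hyr : y r = 0) (hzr : 0 < z r)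
    (hr' : r' ∈ S) (hxr' : x r' = 0) (hyr' : y r' = 0) (hzr' : z r' < 0)
    (hs : s ∈ S) (hxs : 0 < x s) (hys : 0 < y s) (ht : t ∈ S) (hxt : x t < 0) (hyt : 0 < y t)
    (hu : u ∈ S) (hxu : x u < 0) (hyu : y u < 0) : HasLogs (S \ {p}) := by
  have hA := (starConvex_diff_ray hS x y z hr hxr hyr hzr).hasLogs
  have hB := (starConvex_diff_ray hS x y (-z) hr' hxr' hyr' (by simpa using hzr')).hasLogs
  have hopen : ∀ w : E →L[ℝ] ℝ, IsOpen {f | x f ≠ 0 ∨ y f ≠ 0 ∨ 0 < w f} := fun w =>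
    (isOpen_ne_fun x.continuous continuous_const).union
      ((isOpen_ne_fun y.continuous continuous_const).union
        (isOpen_lt continuous_const w.continuous))
  have key : ∀ w : E →L[ℝ] ℝ, (∀ f, w f = 0 ↔ z f = 0) →
      (S \ {p}) ∩ {f | x f ≠ 0 ∨ y f ≠ 0 ∨ 0 < w f} = S ∩ {f | x f ≠ 0 ∨ y f ≠ 0 ∨ 0 < w f} := by
    intro w hw
    ext f
    simp only [Set.mem_inter_iff, Set.mem_sdiff, Set.mem_singleton_iff, Set.mem_ofPred_eq]
    refine ⟨fun h => ⟨h.1.1, h.2⟩, fun h => ⟨⟨h.1, fun hfp => ?_⟩, h.2⟩⟩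
    obtain ⟨h1, h2, h3⟩ := (hp f h.1).1 hfp
    rw [← hw] at h3
    simp [h1, h2, h3] at h
  refine HasLogs.union (hopen z) (hopen (-z)) ?_ ?_ ?_ ?_
  · rintro f ⟨hf, hfp⟩
    have := mt (hp f hf).2 hfp
    simp only [Set.mem_union, Set.mem_ofPred_eq, neg_apply, Left.neg_pos_iff]
    by_contra! hcon
    exact this ⟨hcon.1.1, hcon.1.2.1, le_antisymm hcon.1.2.2 hcon.2.2.2⟩
  · rwa [key z fun _ => Iff.rfl]
  · rwa [key (-z) fun _ => by simp]
  · have := isPreconnected_diff_codim_two hS x y hs hxs hys ht hxt hyt hu hxu hyu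
    convert this using 1
    rw [← Set.inter_assoc, key z fun _ => Iff.rfl]
    ext f
    simp only [Set.mem_inter_iff, Set.mem_ofPred_eq, neg_apply,
      Left.neg_pos_iff]
    constructor
    · rintro ⟨⟨hf, h1⟩, h2⟩
      refine ⟨hf, ?_⟩
      by_contra! hcon
      simp only [hcon.1, hcon.2, ne_eq, not_true_eq_false, false_or] at h1 h2
      exact lt_asymm h1 h2
    · rintro ⟨hf, h | h⟩ <;> simp [hf, h]

end PuncturedConvex

/-! ### Open stars in the geometric realization -/

section Star

variable {V : Type*} [Fintype V]

/-- The union of the open simplices spanned by the sets `G` with `F ⊆ G ⊆ T`: the open star of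
`F` in the full simplex on `T`. -/
def openStar (F T : Finset V) : Set (V → ℝ) :=
  {f | f ∈ stdSimplex ℝ V ∧ (∀ v ∈ F, 0 < f v) ∧ ∀ v ∉ T, f v = 0}

theorem realization_inter_eq_openStar {K : PreAbstractSimplicialComplex V} {F T : Finset V}
    (hT : T ∈ K.faces) (hmax : ∀ G ∈ K.faces, F ⊆ G → G ⊆ T) :
    realization K ∩ {f | ∀ v ∈ F, 0 < f v} = openStar F T := by
  ext f
  constructor
  · rintro ⟨⟨hf, G, hG, hfG⟩, hpos⟩
    have hFG : F ⊆ G := fun v hv => hfG v (hpos v hv).ne'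
    exact ⟨hf, hpos, fun v hv => by_contra fun h => hv (hmax G hG hFG (hfG v h))⟩
  · rintro ⟨hf, hpos, h0⟩
    exact ⟨⟨hf, T, hT, fun v hv => by_contra fun h => hv (h0 v h)⟩, hpos⟩

theorem convex_openStar (F T : Finset V) : Convex ℝ (openStar F T) := by
  rintro f ⟨hf, hfF, hfT⟩ g ⟨hg, hgF, hgT⟩ α β hα hβ hαβ
  refine ⟨convex_stdSimplex ℝ V hf hg hα hβ hαβ, fun v hv => ?_, fun v hv => ?_⟩
  · have h1 := hfF v hv
    have h2 := hgF v hv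
    simp only [Pi.add_apply, Pi.smul_apply, smul_eq_mul]
    rcases hα.eq_or_lt with rfl | hα
    · obtain rfl : β = 1 := by linarith
      simpa using h2
    · positivity
  · simp [hfT v hv, hgT v hv]

variable [DecidableEq V]

/-- The barycentre of the simplex spanned by `F`. -/
noncomputable def barycentre (F : Finset V) : V → ℝ := fun v => if v ∈ F then (F.card : ℝ)⁻¹ else 0

theorem barycentre_mem_openStar {F T : Finset V} (hF : F.Nonempty) (hFT : F ⊆ T) :
    barycentre F ∈ openStar F T := by
  have hc : 0 < (F.card : ℝ) := by exact_mod_cast hF.card_pos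
  refine ⟨⟨fun v => ?_, ?_⟩, fun v hv => ?_, fun v hv => ?_⟩
  · unfold barycentre; split_ifs <;> positivity
  · simp [barycentre, Finset.sum_ite_mem, hc.ne']
  · simp [barycentre, hv, hc]
  · simp [barycentre, mt (@hFT v) hv]

theorem eq_barycentre_of_mem_openStar {F G T : Finset V} {f : V → ℝ} (hf : f ∈ openStar G T)
    {c : ℝ} (hF : ∀ v ∈ F, f v = c) (h0 : ∀ v ∉ F, f v = 0) : f = barycentre F := by
  have hsum : ∑ v ∈ F, f v = 1 := by
    rw [← hf.1.2]
    exact Finset.sum_subset (Finset.subset_univ F) fun v _ hv => h0 v hv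
  rw [Finset.sum_congr rfl hF, Finset.sum_const, nsmul_eq_mul] at hsum
  ext v
  by_cases hv : v ∈ F
  · simp only [barycentre, hv, if_true, hF v hv]
    exact eq_inv_of_mul_eq_one_right hsum
  · simp [barycentre, hv, h0 v hv]

theorem hasLogs_openStar_vertex (a : V) :
    HasLogs (openStar {a} {a} \ {barycentre {a}}) := by
  convert hasLogs_empty
  refine Set.sdiff_eq_empty.2 fun f hf => ?_
  exact eq_barycentre_of_mem_openStar hf (c := f a) (by simp) fun v hv => hf.2.2 v hv

/-- An open edge minus an interior point is a disjoint union of two convex sets. -/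
theorem hasLogs_openStar_edge {a b : V} :
    HasLogs (openStar {a, b} {a, b} \ {barycentre {a, b}}) := by
  set S := openStar ({a, b} : Finset V) {a, b}
  have hS : Convex ℝ S := convex_openStar _ _
  let x : (V → ℝ) →L[ℝ] ℝ :=
    ContinuousLinearMap.proj (R := ℝ) (φ := fun _ => ℝ) a -
      ContinuousLinearMap.proj (R := ℝ) (φ := fun _ => ℝ) b
  have hbary : x (barycentre {a, b}) = 0 := by simp [x, barycentre]
  have key : ∀ w : (V → ℝ) →L[ℝ] ℝ, w (barycentre {a, b}) = 0 →
      (S \ {barycentre {a, b}}) ∩ {f | 0 < w f} = S ∩ {f | 0 < w f} := by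
    intro w hw
    ext f
    refine ⟨fun h => ⟨h.1.1, h.2⟩, fun h => ⟨⟨h.1, fun hf => ?_⟩, h.2⟩⟩
    rw [Set.mem_singleton_iff] at hf
    have := h.2
    simp [hf, hw] at this
  have hopen : ∀ w : (V → ℝ) →L[ℝ] ℝ, IsOpen {f | 0 < w f} := fun w =>
    isOpen_lt continuous_const w.continuous
  refine HasLogs.union (hopen x) (hopen (-x)) ?_ ?_ ?_ ?_
  · rintro f ⟨hf, hfp⟩
    have hne : x f ≠ 0 := by
      intro h0
      have hab : f a = f b := by simpa [x, sub_eq_zero] using h0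
      exact hfp (eq_barycentre_of_mem_openStar hf (c := f a) (by simp [hab])
        fun v hv => hf.2.2 v hv)
    rcases hne.lt_or_gt with h | h
    · exact Or.inr (by simpa using h)
    · exact Or.inl h
  · rw [key x hbary]
    exact (convex_inter_pos hS x).hasLogs
  · rw [key (-x) (by simp [hbary])]
    exact (convex_inter_pos hS (-x)).hasLogs
  · convert isPreconnected_empty
    ext f
    simp only [Set.mem_inter_iff, Set.mem_ofPred_eq, neg_apply,
      Left.neg_pos_iff, Set.mem_empty_iff_false, iff_false, not_and, not_lt]
    exact fun _ h => h.le

/-- Around the midpoint of an edge in a single triangle one sees a half-disc, and the punctured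
half-disc is star-convex about any of its interior points. -/
theorem hasLogs_openStar_boundary_edge {a b t : V} (hta : t ≠ a) (htb : t ≠ b) :
    HasLogs (openStar {a, b} {t, a, b} \ {barycentre {a, b}}) := by
  have hsub : ({a, b} : Finset V) ⊆ {t, a, b} := Finset.subset_insert _ _
  have hs : barycentre ({t, a, b} : Finset V) ∈ openStar {a, b} {t, a, b} := by
    have := barycentre_mem_openStar (F := {t, a, b}) (T := {t, a, b}) (by simp) subset_rfl
    exact ⟨this.1, fun v hv => this.2.1 v (hsub hv), this.2.2⟩
  refine StarConvex.hasLogs (s := barycentre {t, a, b}) ?_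
  rintro f ⟨hf, hfp⟩ α β hα hβ hαβ
  refine ⟨convex_openStar _ _ hs hf hα hβ hαβ, fun heq => ?_⟩
  rw [Set.mem_singleton_iff] at heq hfp
  have hc : 0 < barycentre ({t, a, b} : Finset V) t := by
    simp only [barycentre, Finset.mem_insert_self, if_true]
    positivity
  have ht := congrFun heq t
  have h0 : barycentre ({a, b} : Finset V) t = 0 := by simp [barycentre, hta, htb]
  simp only [Pi.add_apply, Pi.smul_apply, smul_eq_mul, h0] at ht
  have hft : 0 ≤ β * f t := mul_nonneg hβ (hf.1.1 t)
  rcases hα.eq_or_lt with rfl | hα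
  · obtain rfl : β = 1 := by linarith
    exact hfp (by simpa using heq)
  · have := mul_pos hα hc
    linarith

theorem hasLogs_openStar_tetrahedron {a b c d : V} (hab : a ≠ b) (hac : a ≠ c) (had : a ≠ d)
    (hbc : b ≠ c) (hbd : b ≠ d) (hcd : c ≠ d) :
    HasLogs (openStar {a, b, c, d} {a, b, c, d} \ {barycentre {a, b, c, d}}) := by
  set F : Finset V := {a, b, c, d} with hF
  let P : V → (V → ℝ) →L[ℝ] ℝ := fun v => ContinuousLinearMap.proj v
  let pt : ℝ → ℝ → ℝ → ℝ → V → ℝ := fun α β γ δ =>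
    Pi.single a α + Pi.single b β + Pi.single c γ + Pi.single d δ
  have hpa : ∀ α β γ δ, pt α β γ δ a = α := fun α β γ δ => by
    simp [pt, hab, hac, had]
  have hpb : ∀ α β γ δ, pt α β γ δ b = β := fun α β γ δ => by
    simp [pt, hab.symm, hbc, hbd]
  have hpc : ∀ α β γ δ, pt α β γ δ c = γ := fun α β γ δ => by
    simp [pt, hac.symm, hbc.symm, hcd]
  have hpd : ∀ α β γ δ, pt α β γ δ d = δ := fun α β γ δ => by
    simp [pt, had.symm, hbd.symm, hcd.symm]
  have hp0 : ∀ α β γ δ, ∀ v ∉ F, pt α β γ δ v = 0 := fun α β γ δ v hv => by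
    simp only [hF, Finset.mem_insert, Finset.mem_singleton, not_or] at hv
    simp [pt, hv.1, hv.2.1, hv.2.2.1, hv.2.2.2]
  have hpF : ∀ α β γ δ, 0 < α → 0 < β → 0 < γ → 0 < δ → ∀ v ∈ F, 0 < pt α β γ δ v := by
    intro α β γ δ hα hβ hγ hδ v hv
    simp only [hF, Finset.mem_insert, Finset.mem_singleton] at hv
    rcases hv with rfl | rfl | rfl | rfl
    · rwa [hpa]
    · rwa [hpb]
    · rwa [hpc]
    · rwa [hpd]
  have hpt : ∀ α β γ δ, 0 < α → 0 < β → 0 < γ → 0 < δ → α + β + γ + δ = 1 →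
      pt α β γ δ ∈ openStar F F := by
    intro α β γ δ hα hβ hγ hδ hsum
    refine ⟨⟨fun v => ?_, ?_⟩, hpF α β γ δ hα hβ hγ hδ, hp0 α β γ δ⟩
    · by_cases hv : v ∈ F
      · exact (hpF α β γ δ hα hβ hγ hδ v hv).le
      · exact (hp0 α β γ δ v hv).ge
    · simp [pt, Finset.sum_add_distrib, hsum]
  have hbary : ∀ v ∈ F, barycentre F v = (F.card : ℝ)⁻¹ := fun v hv => by simp [barycentre, hv]
  refine hasLogs_diff_singleton_of_three (convex_openStar F F) (P a - P b) (P c - P d)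
    (P a + P b - P c - P d) (r := pt (1/3) (1/3) (1/6) (1/6)) (r' := pt (1/6) (1/6) (1/3) (1/3))
    (s := pt (1/3) (1/6) (1/3) (1/6)) (t := pt (1/6) (1/3) (1/3) (1/6))
    (u := pt (1/6) (1/3) (1/6) (1/3)) ?_
    (hpt _ _ _ _ ?_ ?_ ?_ ?_ ?_) ?_ ?_ ?_ (hpt _ _ _ _ ?_ ?_ ?_ ?_ ?_) ?_ ?_ ?_
    (hpt _ _ _ _ ?_ ?_ ?_ ?_ ?_) ?_ ?_ (hpt _ _ _ _ ?_ ?_ ?_ ?_ ?_) ?_ ?_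
    (hpt _ _ _ _ ?_ ?_ ?_ ?_ ?_) ?_ ?_
  · intro f hf
    simp only [P, sub_apply, add_apply,
      ContinuousLinearMap.proj_apply]
    constructor
    · rintro rfl
      simp [hbary a (by simp [hF]), hbary b (by simp [hF]), hbary c (by simp [hF]),
        hbary d (by simp [hF])]
    · rintro ⟨h1, h2, h3⟩
      refine eq_barycentre_of_mem_openStar hf (c := f a) (fun v hv => ?_) hf.2.2
      simp only [hF, Finset.mem_insert, Finset.mem_singleton] at hv
      rcases hv with rfl | rfl | rfl | rfl <;> linarith
  all_goals
    first
    | norm_num; done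
    | norm_num [P, hpa, hpb, hpc, hpd]

/-- If the open star of a face `F` of a simplicial two-sphere lies in a single simplex `T`, then
it does not become free of winding when the barycentre of `F` is deleted. -/
theorem IsSimplicialSphere.not_hasLogs_openStar {K : PreAbstractSimplicialComplex V}
    (hK : IsSimplicialSphere 2 K) {F T : Finset V} (hF : F.Nonempty) (hFT : F ⊆ T)
    (hT : T ∈ K.faces) (hmax : ∀ G ∈ K.faces, F ⊆ G → G ⊆ T) :
    ¬ HasLogs (openStar F T \ {barycentre F}) := by
  obtain ⟨h⟩ := hK
  have hstar := realization_inter_eq_openStar hT hmax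
  have hO : IsOpen {f : V → ℝ | ∀ v ∈ F, 0 < f v} := by
    have : {f : V → ℝ | ∀ v ∈ F, 0 < f v} = ⋂ v ∈ F, {f | 0 < f v} := by ext; simp
    rw [this]
    exact isOpen_biInter_finset fun v _ => isOpen_lt continuous_const (continuous_apply v)
  have hp := barycentre_mem_openStar hF hFT
  have hp' := hp
  rw [← hstar] at hp'
  obtain ⟨q, hqR, hqO⟩ : ∃ q ∈ realization K, ¬ ∀ v ∈ F, 0 < q v := by
    by_contra! hall
    -- Otherwise every vertex of `T` equals every vertex of `F`, and `realization K` is a point.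
    have hsub : ∀ q ∈ realization K, q ∈ openStar F T := fun q hq => hstar ▸ ⟨hq, hall q hq⟩
    have hvert : ∀ w ∈ T, ∀ v ∈ F, v = w := by
      intro w hw v hv
      by_contra hvw
      have hmem : (Pi.single w 1 : V → ℝ) ∈ realization K :=
        ⟨single_mem_stdSimplex ℝ w, T, hT, fun u hu => by
          by_cases huw : u = w
          · exact huw ▸ hw
          · simp [huw] at hu⟩
      have := hall _ hmem v hv
      simp [hvw] at this
    obtain ⟨a, ha⟩ := hF
    have hTa : ∀ w ∉ ({a} : Finset V), w ∉ T := fun w hw hwT =>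
      hw (by simpa using (hvert w hwT a ha).symm)
    have hsing : Subsingleton (realization K) := ⟨fun f g => Subtype.ext <| by
      have hf := hsub f f.2
      have hg := hsub g g.2
      rw [eq_barycentre_of_mem_openStar (F := {a}) hf (c := (f : V → ℝ) a) (by simp)
          fun v hv => hf.2.2 v (hTa v hv),
        eq_barycentre_of_mem_openStar (F := {a}) hg (c := (g : V → ℝ) a) (by simp)
          fun v hv => hg.2.2 v (hTa v hv)]⟩
    have hsph : Subsingleton (Metric.sphere (0 : EuclideanSpace ℝ (Fin 3)) 1) :=
      h.symm.injective.subsingleton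
    let e : Metric.sphere (0 : EuclideanSpace ℝ (Fin 3)) 1 :=
      ⟨EuclideanSpace.single 0 1, by simp⟩
    have hee := congrArg (fun z : Metric.sphere (0 : EuclideanSpace ℝ (Fin 3)) 1 => z.1 0)
      (Subsingleton.elim e (-e))
    simp [e] at hee
    linarith
  rw [← hstar]
  exact not_hasLogs_punctured_of_homeomorph_sphere h hO hp'.1 hp'.2 hqR hqO

end Star

/-! ### Local conditions on simplicial two-spheres -/

section LocalConditions

variable {V : Type*} [Fintype V] {K : PreAbstractSimplicialComplex V}

theorem IsSimplicialSphere.exists_face {d : ℕ} (hK : IsSimplicialSphere d K) : ∃ F, F ∈ K.faces := by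
  obtain ⟨h⟩ := hK
  obtain ⟨-, F, hF, -⟩ := (h.symm ⟨EuclideanSpace.single 0 1, by simp⟩).2
  exact ⟨F, hF⟩

variable [DecidableEq V]

theorem IsSimplicialSphere.exists_edge_of_vertex (hK : IsSimplicialSphere 2 K) {a : V}
    (ha : {a} ∈ K.faces) : ∃ b ≠ a, {a, b} ∈ K.faces := by
  by_contra! hcon
  refine hK.not_hasLogs_openStar (Finset.singleton_nonempty a) subset_rfl ha
    (fun G hG haG u hu => ?_) (hasLogs_openStar_vertex a)
  by_contra hua
  refine hcon u (by simpa using hua) ((K.isRelLowerSet_faces hG).2 ?_ (by simp))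
  exact Finset.insert_subset (haG (by simp)) (by simpa using hu)

/-- In a simplicial two-sphere every edge lies in at least two triangles. -/
theorem IsSimplicialSphere.exists_two_triangles (hK : IsSimplicialSphere 2 K) {a b : V}
    (hab : {a, b} ∈ K.faces) : ∃ t t', t ≠ t' ∧ (t ≠ a ∧ t ≠ b ∧ {t, a, b} ∈ K.faces) ∧
      (t' ≠ a ∧ t' ≠ b ∧ {t', a, b} ∈ K.faces) := by
  have hsub : ∀ G ∈ K.faces, {a, b} ⊆ G → ∀ u ∈ G, {u, a, b} ∈ K.faces := fun G hG habG u hu =>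
    (K.isRelLowerSet_faces hG).2 (Finset.insert_subset hu habG) (by simp)
  by_cases hex : ∃ t, t ≠ a ∧ t ≠ b ∧ {t, a, b} ∈ K.faces
  · obtain ⟨t, ht⟩ := hex
    by_contra! hcon
    refine hK.not_hasLogs_openStar (F := {a, b}) (by simp) (Finset.subset_insert t _) ht.2.2
      (fun G hG habG u hu => ?_) (hasLogs_openStar_boundary_edge ht.1 ht.2.1)
    by_contra hu'
    simp only [Finset.mem_insert, Finset.mem_singleton, not_or] at hu'
    exact hcon t u (Ne.symm hu'.1) ht hu'.2.1 hu'.2.2 (hsub G hG habG u hu)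
  · refine absurd hasLogs_openStar_edge (hK.not_hasLogs_openStar (F := {a, b}) (by simp) subset_rfl
      hab fun G hG habG u hu => ?_)
    by_contra hu'
    simp only [Finset.mem_insert, Finset.mem_singleton, not_or] at hu'
    exact hex ⟨u, hu'.1, hu'.2, hsub G hG habG u hu⟩

theorem IsSimplicialSphere.card_ne_four (hK : IsSimplicialSphere 2 K)
    (hdim : ∀ G ∈ K.faces, G.card ≤ 4) {F : Finset V} (hF : F ∈ K.faces) : F.card ≠ 4 := by
  intro hcard
  obtain ⟨a, b, c, d, hab, hac, had, hbc, hbd, hcd, rfl⟩ := Finset.card_eq_four.1 hcard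
  exact hK.not_hasLogs_openStar (by simp) subset_rfl hF
    (fun G hG hFG => (Finset.eq_of_subset_of_card_le hFG (hcard ▸ hdim G hG)).ge)
    (hasLogs_openStar_tetrahedron hab hac had hbc hbd hcd)

end LocalConditions

/-! ### The facets of the complex -/

section Facets

variable {V : Type*} [DecidableEq V]

theorem join_generated {A B : Finset (Finset V)} (hA : A.Nonempty) (hB : B.Nonempty) :
    join (generated A) (generated B) = generated (Finset.image₂ (· ∪ ·) A B) := by
  refine SetLike.ext fun H => and_congr_right fun _ => ?_
  constructor
  · rintro ⟨F, G, hF, hG, rfl⟩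
    have key : ∀ {C : Finset (Finset V)} {F : Finset V}, C.Nonempty →
        (F = ∅ ∨ F ∈ (generated C).faces) → ∃ M ∈ C, F ⊆ M := by
      rintro C F ⟨M, hM⟩ (rfl | ⟨-, h⟩)
      · exact ⟨M, hM, Finset.empty_subset _⟩
      · exact h
    obtain ⟨M, hM, hFM⟩ := key hA hF
    obtain ⟨N, hN, hGN⟩ := key hB hG
    exact ⟨_, Finset.mem_image₂_of_mem hM hN, Finset.union_subset_union hFM hGN⟩
  · rintro ⟨P, hP, hH⟩
    obtain ⟨M, hM, N, hN, rfl⟩ := Finset.mem_image₂.1 hP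
    have key : ∀ {C : Finset (Finset V)} {M : Finset V}, M ∈ C →
        (H ∩ M = ∅ ∨ H ∩ M ∈ (generated C).faces) := fun {C M} hM =>
      (H ∩ M).eq_empty_or_nonempty.imp_right fun h => ⟨h, M, hM, Finset.inter_subset_right⟩
    refine ⟨H ∩ M, H ∩ N, key hM, key hN, ?_⟩
    rw [← Finset.inter_union_distrib_left]
    exact (Finset.inter_eq_left.2 hH).symm

theorem generated_sup (A B : Finset (Finset V)) :
    generated A ⊔ generated B = generated (A ∪ B) := by
  refine SetLike.ext fun H => ?_
  change (_ ∧ _) ∨ (_ ∧ _) ↔ _ ∧ _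
  simp only [Finset.mem_union, or_and_right, exists_or, and_or_left]

open Vertex

/-- The facets of `Delta1233`: those of the three cones, then the nine of the staircase. -/
def facetList : List (List Vertex) :=
  [[v1, x1, x2, x3], [v1, x1, x2, y3], [v1, x1, y2, x3], [v1, x1, y2, y3],
   [v1, y1, x2, x3], [v1, y1, x2, y3], [v1, y1, y2, x3], [v1, y1, y2, y3],
   [v2, y1, y2, y3], [v2, y1, y2, z3], [v2, y1, z2, y3], [v2, y1, z2, z3],
   [v2, z1, y2, y3], [v2, z1, y2, z3], [v2, z1, z2, y3], [v2, z1, z2, z3],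
   [v3, x1, x2, x3], [v3, x1, x2, z2], [v3, x1, z1, x3], [v3, x1, z1, z2],
   [v3, z3, x2, x3], [v3, z3, x2, z2], [v3, z3, z1, x3], [v3, z3, z1, z2],
   [z2, y3, x1, x2], [z2, y3, y1, x2], [z2, z3, y1, x2],
   [z3, y1, x2, x3], [z3, y1, y2, x3], [z3, z1, y2, x3],
   [z1, y2, x3, x1], [z1, y2, y3, x1], [z1, z2, y3, x1]]

theorem Delta1233_eq_generated : Delta1233 = generated (facetList.map List.toFinset).toFinset := by
  simp only [Delta1233, Gamma1, Gamma2, cone, octahedron]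
  repeat rw [join_generated (by simp) (by simp)]
  simp only [generated_sup]
  exact congrArg generated (by decide +kernel)

theorem mem_faces_Delta1233 {G : Finset Vertex} :
    G ∈ Delta1233.faces ↔ G.Nonempty ∧ ∃ F ∈ facetList, ∀ v ∈ G, v ∈ F := by
  rw [Delta1233_eq_generated]
  change _ ∧ _ ↔ _
  simp [Finset.subset_iff]

theorem card_of_mem_facetList : ∀ F ∈ facetList, F.toFinset.card = 4 := by decide +kernel

theorem card_le_four_of_mem_faces {G : Finset Vertex} (hG : G ∈ Delta1233.faces) : G.card ≤ 4 := by
  obtain ⟨-, F, hF, hGF⟩ := mem_faces_Delta1233.1 hG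
  rw [← card_of_mem_facetList F hF]
  exact Finset.card_le_card fun v hv => List.mem_toFinset.2 (hGF v hv)

theorem toFinset_mem_faces {F : List Vertex} (hF : F ∈ facetList) :
    F.toFinset ∈ Delta1233.faces :=
  mem_faces_Delta1233.2 ⟨Finset.card_pos.1 (by simp [card_of_mem_facetList F hF]), F, hF, by simp⟩

theorem eq_three_of_hasDimension {n : ℕ} (h : HasDimension Delta1233 n) : n = 3 := by
  obtain ⟨⟨F, hF, hcard⟩, hub⟩ := h
  have h1 := card_le_four_of_mem_faces hF
  have hmem : [v1, x1, x2, x3] ∈ facetList := by simp [facetList]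
  have h2 := hub ⟨_, toFinset_mem_faces hmem, card_of_mem_facetList _ hmem⟩
  omega

end Facets

/-! ### Inspection of the vertex sets -/

section VertexSets

open Vertex

/-- All twelve vertices. -/
def vertexList : List Vertex := [x1, x2, x3, y1, y2, y3, z1, z2, z3, v1, v2, v3]

theorem mem_vertexList (a : Vertex) : a ∈ vertexList := by cases a <;> decide

/-- Adjacency in the one-skeleton of `Delta1233`. -/
def adj (a b : Vertex) : Bool := a != b && facetList.any fun F => F.contains a && F.contains b

theorem adj_iff {a b : Vertex} : adj a b = true ↔ a ≠ b ∧ {a, b} ∈ Delta1233.faces := by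
  simp [adj, mem_faces_Delta1233]

/-- The neighbours of `a` in the one-skeleton of `Delta1233`. -/
def nbrs (a : Vertex) : List Vertex := vertexList.filter (adj a)

theorem mem_nbrs {a b : Vertex} : b ∈ nbrs a ↔ adj a b = true := by
  simp [nbrs, mem_vertexList]

/-- The edges `ab`, each in both orders, with the list of common neighbours of `a` and `b`. -/
def edgeTable : List (Vertex × Vertex × List Vertex) :=
  vertexList.flatMap fun a => (nbrs a).map fun b => (a, b, (nbrs a).filter (adj b))

/-- The list has at most one entry. -/
def atMostOne : List Vertex → Bool
  | [] | [_] => true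
  | _ => false

theorem eq_of_atMostOne {l : List Vertex} (hl : atMostOne l = true) {a b : Vertex} (ha : a ∈ l)
    (hb : b ∈ l) : a = b := by
  match l, hl with
  | [c], _ => simp_all

/-- The vertex set with indicator `w` contains a facet, or an edge whose ends have at most one
common neighbour in the set, or a vertex without neighbours in the set, or it is empty, or it is
the set of neighbours of a vertex. -/
def hasDefectOrIsLink (w : Vertex → Bool) : Bool :=
  (facetList.any fun F => F.all w) ||
  (edgeTable.any fun e => w e.1 && w e.2.1 && atMostOne (e.2.2.filter w)) ||
  (vertexList.any fun a => w a && !(nbrs a).any w) ||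
  (vertexList.all fun a => !w a) ||
  (vertexList.any fun a => vertexList.all fun b => w b == (nbrs a).contains b)

/-- The indicator of a vertex set with the given values at the twelve vertices. -/
def ofBits (a b c d e f g h i j k l : Bool) : Vertex → Bool
  | x1 => a | x2 => b | x3 => c | y1 => d | y2 => e | y3 => f | z1 => g | z2 => h | z3 => i
  | v1 => j | v2 => k | v3 => l

/-- The evaluation on all `2 ^ 12` vertex sets. -/
theorem hasDefectOrIsLink_ofBits : ∀ a b c d e f g h i j k l,
    hasDefectOrIsLink (ofBits a b c d e f g h i j k l) = true := by
  decide +kernel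

theorem hasDefectOrIsLink_eq_true (w : Vertex → Bool) : hasDefectOrIsLink w = true := by
  have h := hasDefectOrIsLink_ofBits (w x1) (w x2) (w x3) (w y1) (w y2) (w y3) (w z1) (w z2) (w z3)
    (w v1) (w v2) (w v3)
  rwa [show ofBits _ _ _ _ _ _ _ _ _ _ _ _ = w from funext fun v => by cases v <;> rfl] at h

theorem vertexSet_cases (W : Finset Vertex) :
    (∃ F ∈ facetList, ∀ v ∈ F, v ∈ W) ∨
    (∃ a ∈ W, ∃ b ∈ W, adj a b = true ∧ ∀ t ∈ W, ∀ t' ∈ W, adj a t = true → adj b t = true →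
      adj a t' = true → adj b t' = true → t = t') ∨
    (∃ a ∈ W, ∀ b ∈ W, adj a b = false) ∨ W = ∅ ∨ ∃ a, ∀ b, b ∈ W ↔ adj a b = true := by
  have h := hasDefectOrIsLink_eq_true fun v => decide (v ∈ W)
  simp only [hasDefectOrIsLink, Bool.or_eq_true] at h
  rcases h with (((h | h) | h) | h) | h
  · left
    simpa using h
  · right; left
    obtain ⟨e, he, hw⟩ := List.any_eq_true.1 h
    simp only [edgeTable, List.mem_flatMap, List.mem_map] at he
    obtain ⟨a, -, b, hb, rfl⟩ := he
    simp only [Bool.and_eq_true, decide_eq_true_eq] at hw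
    refine ⟨a, hw.1.1, b, hw.1.2, mem_nbrs.1 hb, fun t ht t' ht' h1 h2 h3 h4 => ?_⟩
    exact eq_of_atMostOne hw.2 (by simp [mem_nbrs, *]) (by simp [mem_nbrs, *])
  · right; right; left
    obtain ⟨a, -, ha⟩ := List.any_eq_true.1 h
    simp only [Bool.and_eq_true, decide_eq_true_eq, Bool.not_eq_true', List.any_eq_false] at ha
    exact ⟨a, ha.1, fun b hb => Bool.eq_false_iff.2 fun hab => ha.2 b (mem_nbrs.2 hab) hb⟩
  · right; right; right; left
    simp only [List.all_eq_true, Bool.not_eq_true', decide_eq_false_iff_not] at h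
    exact Finset.eq_empty_of_forall_notMem fun a => h a (mem_vertexList a)
  · right; right; right; right
    obtain ⟨a, -, ha⟩ := List.any_eq_true.1 h
    refine ⟨a, fun b => ?_⟩
    have hb := List.all_eq_true.1 ha b (mem_vertexList b)
    rw [beq_iff_eq, Bool.eq_iff_iff, decide_eq_true_eq, List.contains_iff_mem, mem_nbrs] at hb
    exact hb

/-- Flagness around a vertex: the neighbours of `a` in a facet span a face together with `a`. -/
theorem exists_facet_of_adj : ∀ a, ∀ F ∈ facetList, ∃ F' ∈ facetList, a ∈ F' ∧
    ∀ u ∈ F, adj a u = true → u ∈ F' := by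
  decide +kernel

theorem induced_nbrs_eq_link {W : Finset Vertex} {a : Vertex}
    (hW : ∀ b, b ∈ W ↔ adj a b = true) : induced Delta1233 W = link Delta1233 {a} := by
  refine SetLike.ext fun G => and_congr_right fun hG => ⟨fun hGW => ⟨?_, ?_⟩, ?_⟩
  · obtain ⟨-, F, hF, hGF⟩ := mem_faces_Delta1233.1 hG
    obtain ⟨F', hF', haF', h⟩ := exists_facet_of_adj a F hF
    refine mem_faces_Delta1233.2 ⟨by simp, F', hF', fun u hu => ?_⟩
    rcases Finset.mem_union.1 hu with hu | hu
    · rwa [Finset.mem_singleton.1 hu]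
    · exact h u (hGF u hu) ((hW u).1 (hGW hu))
  · rw [Finset.singleton_inter_of_notMem]
    exact fun ha => (adj_iff.1 ((hW a).1 (hGW ha))).1 rfl
  · rintro ⟨haG, hdisj⟩ u hu
    refine (hW u).2 (adj_iff.2 ⟨?_, ?_⟩)
    · rintro rfl
      exact Finset.notMem_empty a (hdisj ▸ Finset.mem_inter.2 ⟨by simp, hu⟩)
    · refine (Delta1233.isRelLowerSet_faces haG).2 ?_ (by simp)
      exact Finset.insert_subset (by simp) (by simp [hu])

end VertexSets

end FlagSphere

open FlagSphere in
theorem mainTheorem1 (E : PreAbstractSimplicialComplex FlagSphere.Vertex)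
    (hE : FlagSphere.IsInducedEquator FlagSphere.Delta1233 E) :
    ∃ v : FlagSphere.Vertex, {v} ∈ FlagSphere.Delta1233.faces ∧
      E = FlagSphere.link FlagSphere.Delta1233 {v} := by
  obtain ⟨⟨W, rfl⟩, d, hdim, hE⟩ := hE
  obtain rfl : d = 2 := by have := eq_three_of_hasDimension hdim; omega
  have hvert : ∀ a, {a} ∈ Delta1233.faces := fun a => by
    obtain ⟨F', hF', haF', -⟩ := exists_facet_of_adj a _ (List.mem_cons_self ..)
    exact mem_faces_Delta1233.2 ⟨by simp, F', hF', by simpa using haF'⟩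
  rcases vertexSet_cases W with h | h | h | h | h
  · obtain ⟨F, hF, hFW⟩ := h
    refine absurd (card_of_mem_facetList F hF) (hE.card_ne_four
      (fun G hG => card_le_four_of_mem_faces hG.1) ⟨toFinset_mem_faces hF, fun v hv => ?_⟩)
    exact hFW v (List.mem_toFinset.1 hv)
  · obtain ⟨a, ha, b, hb, hab, huniq⟩ := h
    obtain ⟨t, t', hne, ht, ht'⟩ := hE.exists_two_triangles (a := a) (b := b)
      ⟨(adj_iff.1 hab).2, by simp [Finset.insert_subset_iff, ha, hb]⟩
    have key : ∀ t, t ≠ a → t ≠ b → {t, a, b} ∈ (induced Delta1233 W).faces →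
        t ∈ W ∧ adj a t = true ∧ adj b t = true := fun t hta htb ht =>
      ⟨ht.2 (by simp),
        adj_iff.2 ⟨hta.symm, (Delta1233.isRelLowerSet_faces ht.1).2
          (by simp [Finset.insert_subset_iff]) (by simp)⟩,
        adj_iff.2 ⟨htb.symm, (Delta1233.isRelLowerSet_faces ht.1).2
          (by simp [Finset.insert_subset_iff]) (by simp)⟩⟩
    obtain ⟨h1, h2, h3⟩ := key t ht.1 ht.2.1 ht.2.2
    obtain ⟨h1', h2', h3'⟩ := key t' ht'.1 ht'.2.1 ht'.2.2
    exact absurd (huniq t h1 t' h1' h2 h3 h2' h3') hne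
  · obtain ⟨a, ha, hiso⟩ := h
    obtain ⟨b, hba, hab⟩ := hE.exists_edge_of_vertex (a := a) ⟨hvert a, by simpa using ha⟩
    have := adj_iff.2 ⟨hba.symm, hab.1⟩
    rw [hiso b (hab.2 (by simp))] at this
    exact absurd this (by simp)
  · obtain ⟨F, hF, hFW⟩ := hE.exists_face
    obtain ⟨v, hv⟩ := (mem_faces_Delta1233.1 hF).1
    exact absurd (hFW hv) (by simp [h])
  · obtain ⟨a, ha⟩ := h
    exact ⟨a, hvert a, induced_nbrs_eq_link ha⟩
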